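/- Let $1\le m\le n$. Equip $V_{m,n}=\bigwedge^m\mathbb R^n$ with the inner product $\langle\cdot,\cdot\rangle$ for which the vectors $e_{i_1}\wedge\dots\wedge e_{i_m}$, $1\le i_1<\dots<i_m\le n$, form an orthonormal basis, where $e_1,\dots,e_n$ is the standard basis of $\mathbb R^n$. Let $G_m(\mathbb R^n)\subset V_{m,n}$ be the Plücker embedding of the Grassmannian of oriented $m$-dimensional subspaces of $\mathbb R^n$, that is, the set of all $v_1\wedge\dots\wedge v_m$ with $v_1,\dots,v_m\in\mathbb R^n$ orthonormal. Call $c\in V_{m,n}$ a calibration (a vector of comass $1$) if $\max_{x\in G_m(\mathbb R^n)}\langle c,x\rangle=1$. (1) For all integers $1\le m\le n$, every calibration $c\in V_{m,n}$ satisfies $\langle c,c\rangle\le\binom{n}{m}$. (2) There is an absolute constant $\alpha>0$ such that for all integers $1\le m\le n$ there exists a calibration $c\in V_{m,n}$ with $$\langle c,c\rangle\ \ge\ \alpha\,\bigl(nm\ln(m+1)\bigr)^{-1}\binom{n}{m}.$$ -/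

import Mathlib

/-- The Plücker image of the Grassmannian of oriented `m`-dimensional subspaces of `ℝⁿ` in
`⋀^m ℝⁿ`: an oriented subspace with positively oriented orthonormal basis `v₁, …, v_m` is the
point `v₁ ∧ ⋯ ∧ v_m`. Its coordinates with respect to the vectors `e_{i₁} ∧ ⋯ ∧ e_{i_m}`,
`i₁ < ⋯ < i_m`, are the `m × m` minors of the matrix of the `v_j`. -/
def orientedGrassmannian (m n : ℕ) : Set (⋀[ℝ]^m (EuclideanSpace ℝ (Fin n))) :=
  {x | ∃ v : Fin m → EuclideanSpace ℝ (Fin n),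
    Orthonormal ℝ v ∧ x = exteriorPower.ιMulti ℝ m v}

/-- `c` has comass `r`: the maximum of `⟨c, x⟩` over `x` in the oriented Grassmannian exists and
equals `r`. Here `⋀^m ℝⁿ` carries the inner product for which the vectors
`e_{i₁} ∧ ⋯ ∧ e_{i_m}`, `i₁ < ⋯ < i_m`, are orthonormal (Mathlib's
`OrthonormalBasis.exteriorPower`), and `c` stands for the linear functional `⟨c, ·⟩`. -/
def HasComass {m n : ℕ} (c : ⋀[ℝ]^m (EuclideanSpace ℝ (Fin n))) (r : ℝ) : Prop :=
  IsGreatest ((fun x => inner ℝ c x) '' orientedGrassmannian m n) r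

/-- A calibration is a linear functional (here a vector) of comass `1`. -/
def IsCalibration {m n : ℕ} (c : ⋀[ℝ]^m (EuclideanSpace ℝ (Fin n))) : Prop :=
  HasComass c 1

/-! The upper bound is Parseval: the standard basis vectors of `⋀^m ℝⁿ` lie, up to sign, in the
Grassmannian, so every coordinate of a calibration is at most 1 in absolute value.

The lower bound is probabilistic. A vector with coordinates `±1` has squared norm `n.choose m`, so
it suffices to choose signs making the comass `O(√(n m log (m + 1)))` and then rescale. Tuples from
a `1/(2m)`-net of the unit ball give at most `(1 + 4m)^(nm)` test vectors, each of norm at most 1 by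
Hadamard; an exponential-moment union bound (`exists_sign_sum_le_sqrt`) handles them all at once.
Multilinearity bounds the comass by twice the maximum over the net. -/

theorem card_le_of_pairwise_le_norm_sub {E : Type*} [NormedAddCommGroup E] [NormedSpace ℝ E]
    [FiniteDimensional ℝ E] {k : ℕ} (hk : 0 < k) (s : Finset E) (hs : ∀ c ∈ s, ‖c‖ ≤ 1)
    (h : ∀ c ∈ s, ∀ d ∈ s, c ≠ d → (k : ℝ)⁻¹ ≤ ‖c - d‖) :
    s.card ≤ (1 + 2 * k) ^ Module.finrank ℝ E := by
  open MeasureTheory Metric Set Module in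
  borelize E
  let μ : Measure E := Measure.addHaar
  have hk' : (0 : ℝ) < k := by exact_mod_cast hk
  set δ : ℝ := (2 * k : ℝ)⁻¹ with hδ
  have δpos : 0 < δ := by positivity
  have ρpos : 0 < 1 + δ := by positivity
  have hδk : δ + δ = (k : ℝ)⁻¹ := by rw [hδ]; field_simp; norm_num
  set A := ⋃ c ∈ s, ball (c : E) δ with hA
  have D : Set.Pairwise (s : Set E) (Function.onFun Disjoint fun c => ball (c : E) δ) := by
    rintro c hc d hd hcd
    apply ball_disjoint_ball
    rw [dist_eq_norm, hδk]
    exact h c hc d hd hcd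
  have A_subset : A ⊆ ball (0 : E) (1 + δ) := by
    refine iUnion₂_subset fun x hx => ball_subset_ball' ?_
    rw [dist_zero_right, add_comm]
    exact add_le_add (hs x hx) le_rfl
  have I : (s.card : ENNReal) * ENNReal.ofReal (δ ^ finrank ℝ E) * μ (ball 0 1) ≤
      ENNReal.ofReal ((1 + δ) ^ finrank ℝ E) * μ (ball 0 1) :=
    calc
      (s.card : ENNReal) * ENNReal.ofReal (δ ^ finrank ℝ E) * μ (ball 0 1) = μ A := by
        rw [hA, measure_biUnion_finset D fun c _ => measurableSet_ball]
        simp only [μ.addHaar_ball_of_pos _ δpos, Finset.sum_const, nsmul_eq_mul, mul_assoc]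
      _ ≤ μ (ball (0 : E) (1 + δ)) := measure_mono A_subset
      _ = _ := by simp only [μ.addHaar_ball_of_pos _ ρpos]
  have J : (s.card : ENNReal) * ENNReal.ofReal (δ ^ finrank ℝ E) ≤
      ENNReal.ofReal ((1 + δ) ^ finrank ℝ E) :=
    (ENNReal.mul_le_mul_iff_left (measure_ball_pos _ _ zero_lt_one).ne'
      measure_ball_lt_top.ne).1 I
  have K : (s.card : ℝ) * δ ^ finrank ℝ E ≤ (1 + δ) ^ finrank ℝ E := by
    have := ENNReal.toReal_le_of_le_ofReal (pow_nonneg ρpos.le _) J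
    simpa [δpos.le] using this
  have e : (1 + δ) = (1 + 2 * k) * δ := by rw [hδ]; field_simp; ring
  rw [e, mul_pow] at K
  have := le_of_mul_le_mul_right K (by positivity)
  exact_mod_cast this

/-! ### Nets from maximal separated sets -/

theorem exists_finset_net_unit_ball (E : Type*) [NormedAddCommGroup E] [NormedSpace ℝ E]
    [FiniteDimensional ℝ E] {k : ℕ} (hk : 0 < k) :
    ∃ s : Finset E, (∀ c ∈ s, ‖c‖ ≤ 1) ∧ s.card ≤ (1 + 2 * k) ^ Module.finrank ℝ E ∧
      ∀ x : E, ‖x‖ ≤ 1 → ∃ c ∈ s, ‖x - c‖ ≤ (k : ℝ)⁻¹ := by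
  classical
  let P : ℕ → Prop := fun N => ∃ s : Finset E, s.card = N ∧ (∀ c ∈ s, ‖c‖ ≤ 1) ∧
    ∀ c ∈ s, ∀ d ∈ s, c ≠ d → (k : ℝ)⁻¹ ≤ ‖c - d‖
  have hP0 : P 0 := ⟨∅, by simp⟩
  have hb : ∀ N, P N → N ≤ (1 + 2 * k) ^ Module.finrank ℝ E := by
    rintro N ⟨s, rfl, h1, h2⟩
    exact card_le_of_pairwise_le_norm_sub hk s h1 h2
  -- A separated set of maximal size is a net: an uncovered point could be added to it.
  obtain ⟨s, hcard, h1, h2⟩ := Nat.findGreatest_spec (P := P) (Nat.zero_le _) hP0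
  refine ⟨s, h1, card_le_of_pairwise_le_norm_sub hk s h1 h2, fun x hx => ?_⟩
  by_contra! hcon
  have hxs : x ∉ s := fun hxs => by
    have := hcon x hxs
    rw [sub_self, norm_zero] at this
    exact absurd this (not_lt.2 (by positivity))
  have hPs : P (s.card + 1) := by
    refine ⟨insert x s, Finset.card_insert_of_notMem hxs, ?_, ?_⟩
    · simp only [Finset.mem_insert, forall_eq_or_imp]
      exact ⟨hx, h1⟩
    · intro c hc d hd hcd
      rcases Finset.mem_insert.1 hc with rfl | hc' <;>
        rcases Finset.mem_insert.1 hd with rfl | hd'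
      · exact absurd rfl hcd
      · exact (hcon d hd').le
      · rw [norm_sub_rev]; exact (hcon c hc').le
      · exact h2 c hc' d hd' hcd
  have := Nat.le_findGreatest (hb _ hPs) hPs
  rw [hcard] at this
  exact absurd this (Nat.not_succ_le_self _)

/-! ### Random signs -/

open Finset Real in
-- Since `cosh t ≤ exp (t² / 2)`, each `exp (l * ∑ ε i * x i)` has mean at most `exp L` over all
-- signs. Some choice therefore keeps their sum over `T` below `exp (2 * L)`, and so each term; `l²
-- = 2 * L` turns this into the bound `l`.
theorem exists_sign_sum_le_sqrt {ι : Type*} [Fintype ι] (T : Finset (ι → ℝ))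
    (hT : ∀ x ∈ T, ∑ i, x i ^ 2 ≤ 1) {L : ℝ} (hL : 0 < L) (hcard : (T.card : ℝ) ≤ exp L) :
    ∃ ε : ι → ℝ, (∀ i, ε i ^ 2 = 1) ∧ ∀ x ∈ T, ∑ i, ε i * x i ≤ √(2 * L) := by
  classical
  set l := √(2 * L) with hl
  have hlpos : 0 < l := by positivity
  have hl2 : l ^ 2 = 2 * L := sq_sqrt (by positivity)
  let σ : Bool → ℝ := fun b => if b then 1 else -1
  have key : ∀ x ∈ T, ∑ s : ι → Bool, exp (l * ∑ i, σ (s i) * x i) ≤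
      2 ^ Fintype.card ι * exp L := by
    intro x hx
    have h1 : ∀ s : ι → Bool, exp (l * ∑ i, σ (s i) * x i) = ∏ i, exp (l * (σ (s i) * x i)) := by
      intro s
      rw [mul_sum, exp_sum]
    have h2 := (Finset.prod_univ_sum (fun _ : ι => (univ : Finset Bool))
      (fun i b => exp (l * (σ b * x i)))).symm
    rw [Fintype.piFinset_univ] at h2
    simp_rw [h1]
    rw [h2]
    have h3 : ∀ i, ∑ b : Bool, exp (l * (σ b * x i)) ≤ 2 * exp (L * x i ^ 2) := by
      intro i
      have := cosh_le_exp_half_sq (l * x i)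
      rw [cosh_eq, mul_pow, hl2, show 2 * L * x i ^ 2 / 2 = L * x i ^ 2 by ring] at this
      simp only [Fintype.sum_bool, σ, if_true, Bool.false_eq_true, if_false, one_mul, neg_one_mul,
        mul_neg]
      linarith
    calc _ ≤ ∏ i, (2 * exp (L * x i ^ 2)) :=
          prod_le_prod (fun i _ => sum_nonneg fun _ _ => (exp_pos _).le) fun i _ => h3 i
      _ = 2 ^ Fintype.card ι * exp (L * ∑ i, x i ^ 2) := by
          rw [prod_mul_distrib, prod_const, card_univ, ← exp_sum, mul_sum]
      _ ≤ _ := by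
          gcongr
          nlinarith [hT x hx]
  have hsum : ∑ s : ι → Bool, ∑ x ∈ T, exp (l * ∑ i, σ (s i) * x i) ≤
      ∑ _s : ι → Bool, exp L * exp L := by
    rw [sum_comm]
    calc _ ≤ ∑ x ∈ T, 2 ^ Fintype.card ι * exp L := sum_le_sum key
      _ = T.card * (2 ^ Fintype.card ι * exp L) := by simp
      _ ≤ exp L * (2 ^ Fintype.card ι * exp L) := by gcongr
      _ = _ := by simp; ring
  obtain ⟨s, -, hs⟩ := exists_le_of_sum_le univ_nonempty hsum
  refine ⟨fun i => σ (s i), fun i => ?_, fun x hx => ?_⟩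
  · by_cases h : s i <;> simp [σ, h]
  · have h := (single_le_sum (f := fun x : ι → ℝ => exp (l * ∑ i, σ (s i) * x i))
      (fun _ _ => (exp_pos _).le) hx).trans hs
    rw [← exp_add, exp_le_exp] at h
    refine le_of_mul_le_mul_left (h.trans ?_) hlpos
    nlinarith

/-! ### Hadamard's inequality -/

open Module in
/-- Hadamard's inequality for an alternating form, reducing it to orthonormal families. -/
theorem AlternatingMap.exists_orthonormal_abs_le {E : Type*} [NormedAddCommGroup E]
    [InnerProductSpace ℝ E] [FiniteDimensional ℝ E] {m : ℕ} (hm : m ≤ finrank ℝ E)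
    (f : E [⋀^Fin m]→ₗ[ℝ] ℝ) (w : Fin m → E) :
    ∃ u : Fin m → E, Orthonormal ℝ u ∧ |f w| ≤ |f u| * ∏ i, ‖w i‖ := by
  by_cases hw : LinearIndependent ℝ w
  · let W := Submodule.span ℝ (Set.range w)
    have hW : finrank ℝ W = m := by
      rw [finrank_span_eq_card hw, Fintype.card_fin]
    have : Fact (finrank ℝ W = m) := ⟨hW⟩
    let b : OrthonormalBasis (Fin m) ℝ W := (stdOrthonormalBasis ℝ W).reindex (finCongr hW)
    let y : Fin m → W := fun i => ⟨w i, Submodule.subset_span ⟨i, rfl⟩⟩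
    let g : W [⋀^Fin m]→ₗ[ℝ] ℝ := f.compLinearMap W.subtype
    refine ⟨fun i => b i, b.orthonormal.comp_linearIsometry W.subtypeₗᵢ, ?_⟩
    -- On the `m`-dimensional span of `w`, the form is a multiple of the determinant.
    have h1 : f w = f (fun i => b i) * b.toBasis.det y := by
      have := congrArg (fun g : W [⋀^Fin m]→ₗ[ℝ] ℝ => g y) (g.eq_smul_basis_det b.toBasis)
      simpa [g, y] using this
    have h2 : |b.toBasis.det y| ≤ ∏ i, ‖w i‖ := by
      let o : Orientation ℝ W (Fin m) := b.toBasis.orientation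
      rw [← o.volumeForm_robust' b]
      exact o.abs_volumeForm_apply_le y
    rw [h1, abs_mul]
    gcongr
  · refine ⟨fun i => stdOrthonormalBasis ℝ E (Fin.castLE hm i),
      (stdOrthonormalBasis ℝ E).orthonormal.comp _ (Fin.castLE_injective hm), ?_⟩
    rw [f.map_linearDependent w hw, abs_zero]
    positivity

open Module

/-! ### Comass and the upper bound -/

section

variable {m n : ℕ}

/-- The alternating form `v ↦ ⟨c, v₁ ∧ ⋯ ∧ v_m⟩`. -/
noncomputable def innerιMulti (c : ⋀[ℝ]^m (EuclideanSpace ℝ (Fin n))) :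
    EuclideanSpace ℝ (Fin n) [⋀^Fin m]→ₗ[ℝ] ℝ :=
  (innerₗ _ c).compAlternatingMap (exteriorPower.ιMulti ℝ m)

theorem innerιMulti_apply (c : ⋀[ℝ]^m (EuclideanSpace ℝ (Fin n)))
    (v : Fin m → EuclideanSpace ℝ (Fin n)) :
    innerιMulti c v = inner ℝ c (exteriorPower.ιMulti ℝ m v) := rfl

theorem norm_ιMulti_of_orthonormal {v : Fin m → EuclideanSpace ℝ (Fin n)}
    (hv : Orthonormal ℝ v) : ‖exteriorPower.ιMulti ℝ m v‖ = 1 := by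
  have h : ‖exteriorPower.ιMulti ℝ m v‖ ^ 2 = 1 := by
    rw [← real_inner_self_eq_norm_sq, exteriorPower.inner_ιMulti_self,
      Matrix.gram_eq_one_iff_orthonormal.2 hv, Matrix.det_one]
  exact (pow_eq_one_iff_of_nonneg (norm_nonneg _) two_ne_zero).1 h

/-- Hadamard applied to the form `⟨x, ·⟩` with `x` the wedge of `w` itself, then Cauchy–Schwarz. -/
theorem norm_ιMulti_le (hmn : m ≤ n) (w : Fin m → EuclideanSpace ℝ (Fin n)) :
    ‖exteriorPower.ιMulti ℝ m w‖ ≤ ∏ i, ‖w i‖ := by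
  set x := exteriorPower.ιMulti ℝ m w with hx
  rcases (norm_nonneg x).eq_or_lt with h0 | h0
  · rw [← h0]; positivity
  obtain ⟨u, hu, h⟩ := (innerιMulti x).exists_orthonormal_abs_le (by simpa using hmn) w
  rw [innerιMulti_apply, innerιMulti_apply, ← hx, real_inner_self_eq_norm_sq,
    abs_of_nonneg (by positivity)] at h
  have h2 := abs_real_inner_le_norm x (exteriorPower.ιMulti ℝ m u)
  rw [norm_ιMulti_of_orthonormal hu, mul_one] at h2
  have h3 : ‖x‖ ^ 2 ≤ ‖x‖ * ∏ i, ‖w i‖ := h.trans (by gcongr)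
  rw [pow_two] at h3
  exact le_of_mul_le_mul_left h3 h0

theorem exteriorPower_basisFun_eq (s : Set.powersetCard (Fin n) m) :
    (EuclideanSpace.basisFun (Fin n) ℝ).exteriorPower m s =
      exteriorPower.ιMulti ℝ m
        (fun i => EuclideanSpace.basisFun (Fin n) ℝ (Set.powersetCard.ofFinEmbEquiv.symm s i)) := by
  rw [← OrthonormalBasis.coe_toBasis, OrthonormalBasis.toBasis_exteriorPower,
    exteriorPower.coe_basis, OrthonormalBasis.coe_toBasis]
  rfl

theorem orthonormal_basisFun_comp (s : Set.powersetCard (Fin n) m) :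
    Orthonormal ℝ (fun i =>
      EuclideanSpace.basisFun (Fin n) ℝ (Set.powersetCard.ofFinEmbEquiv.symm s i)) :=
  (EuclideanSpace.basisFun (Fin n) ℝ).orthonormal.comp _ (RelEmbedding.injective _)

theorem exteriorPower_basisFun_mem (s : Set.powersetCard (Fin n) m) :
    (EuclideanSpace.basisFun (Fin n) ℝ).exteriorPower m s ∈ orientedGrassmannian m n :=
  ⟨_, orthonormal_basisFun_comp s, exteriorPower_basisFun_eq s⟩

theorem neg_mem_orientedGrassmannian (hm : 1 ≤ m) {x : ⋀[ℝ]^m (EuclideanSpace ℝ (Fin n))}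
    (hx : x ∈ orientedGrassmannian m n) : -x ∈ orientedGrassmannian m n := by
  obtain ⟨v, hv, rfl⟩ := hx
  let i : Fin m := ⟨0, hm⟩
  refine ⟨Function.update v i (-v i), ⟨fun j => ?_, fun j k hjk => ?_⟩, ?_⟩
  · by_cases h : j = i
    · subst h; simp [hv.1]
    · simp [h, hv.1]
  · by_cases h : j = i
    · subst h; simp [hjk.symm, hv.2 hjk]
    · by_cases h' : k = i
      · subst h'; simp [h, hv.2 hjk]
      · simp [h, h', hv.2 hjk]
  · rw [AlternatingMap.map_update_neg, Function.update_eq_self]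

theorem HasComass.abs_inner_le (hm : 1 ≤ m) {c : ⋀[ℝ]^m (EuclideanSpace ℝ (Fin n))} {r : ℝ}
    (hc : HasComass c r) {x} (hx : x ∈ orientedGrassmannian m n) : |inner ℝ c x| ≤ r := by
  refine abs_le'.2 ⟨hc.2 ⟨x, hx, rfl⟩, ?_⟩
  rw [← inner_neg_right]
  exact hc.2 ⟨-x, neg_mem_orientedGrassmannian hm hx, rfl⟩

theorem card_powersetCard_fin : Fintype.card (Set.powersetCard (Fin n) m) = n.choose m := by
  rw [← Nat.card_eq_fintype_card, Set.powersetCard.card, Nat.card_eq_fintype_card, Fintype.card_fin]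

theorem IsCalibration.inner_self_le (hm : 1 ≤ m) {c : ⋀[ℝ]^m (EuclideanSpace ℝ (Fin n))}
    (hc : IsCalibration c) : inner ℝ c c ≤ (n.choose m : ℝ) := by
  rw [real_inner_self_eq_norm_sq,
    ← ((EuclideanSpace.basisFun (Fin n) ℝ).exteriorPower m).sum_sq_norm_inner_left c]
  calc _ ≤ ∑ _s : Set.powersetCard (Fin n) m, (1 : ℝ) := Finset.sum_le_sum fun s _ => by
        rw [Real.norm_eq_abs, sq_abs, sq_le_one_iff_abs_le_one]
        exact hc.abs_inner_le hm (exteriorPower_basisFun_mem s)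
    _ = _ := by rw [Finset.sum_const, Finset.card_univ, card_powersetCard_fin, nsmul_one]

theorem continuous_ιMulti (hmn : m ≤ n) :
    Continuous fun v : Fin m → EuclideanSpace ℝ (Fin n) => exteriorPower.ιMulti ℝ m v :=
  AlternatingMap.continuous_of_bound _ 1 fun v => by simpa using norm_ιMulti_le hmn v

theorem inner_smul_left_exteriorPower (a : ℝ) (x y : ⋀[ℝ]^m (EuclideanSpace ℝ (Fin n))) :
    inner ℝ (a • x) y = a * inner ℝ x y :=
  real_inner_smul_left x y a

theorem exists_hasComass (hmn : m ≤ n) (c : ⋀[ℝ]^m (EuclideanSpace ℝ (Fin n))) :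
    ∃ r, HasComass c r := by
  let K : Set (Fin m → EuclideanSpace ℝ (Fin n)) := {v | Orthonormal ℝ v}
  have hK : IsCompact K := by
    refine Metric.isCompact_of_isClosed_isBounded ?_ ?_
    · simp only [K, orthonormal_iff_ite, Set.ofPred_forall]
      refine isClosed_iInter fun i => isClosed_iInter fun j => isClosed_eq (by fun_prop)
        continuous_const
    · refine (Metric.isBounded_closedBall (x := 0) (r := 1)).subset fun v hv => ?_
      rw [mem_closedBall_zero_iff, pi_norm_le_iff_of_nonneg zero_le_one]
      exact fun i => (hv.1 i).le
  have hne : K.Nonempty := ⟨fun i => EuclideanSpace.basisFun (Fin n) ℝ (Fin.castLE hmn i),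
    (EuclideanSpace.basisFun (Fin n) ℝ).orthonormal.comp _ (Fin.castLE_injective hmn)⟩
  obtain ⟨u, hu, h⟩ := hK.exists_isMaxOn hne
    (f := fun v => inner ℝ c (exteriorPower.ιMulti ℝ m v))
    (continuous_const.inner (continuous_ιMulti hmn)).continuousOn
  refine ⟨_, ⟨_, ⟨u, hu, rfl⟩, rfl⟩, ?_⟩
  rintro _ ⟨_, ⟨v, hv, rfl⟩, rfl⟩
  exact h hv

theorem HasComass.abs_innerιMulti_le (hm : 1 ≤ m) (hmn : m ≤ n)
    {c : ⋀[ℝ]^m (EuclideanSpace ℝ (Fin n))} {r : ℝ} (hc : HasComass c r)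
    (w : Fin m → EuclideanSpace ℝ (Fin n)) : |innerιMulti c w| ≤ r * ∏ i, ‖w i‖ := by
  obtain ⟨u, hu, h⟩ := (innerιMulti c).exists_orthonormal_abs_le (by simpa using hmn) w
  refine h.trans ?_
  gcongr
  exact hc.abs_inner_le hm ⟨u, hu, rfl⟩

theorem HasComass.nonneg (hm : 1 ≤ m) {c : ⋀[ℝ]^m (EuclideanSpace ℝ (Fin n))} {r : ℝ}
    (hc : HasComass c r) : 0 ≤ r := by
  obtain ⟨x, hx, -⟩ := hc.1
  exact (abs_nonneg _).trans (hc.abs_inner_le hm hx)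

/-! ### Comass of a random sign vector -/

/-- The comass is controlled by the values on a `1 / (2m)`-net of the unit ball in each slot. -/
theorem HasComass.le_two_mul_of_net (hm : 1 ≤ m) (hmn : m ≤ n)
    {c : ⋀[ℝ]^m (EuclideanSpace ℝ (Fin n))} {r : ℝ} (hc : HasComass c r)
    {S : Finset (EuclideanSpace ℝ (Fin n))} (hS : ∀ x ∈ S, ‖x‖ ≤ 1)
    (hnet : ∀ x : EuclideanSpace ℝ (Fin n), ‖x‖ ≤ 1 →
      ∃ y ∈ S, ‖x - y‖ ≤ ((2 * m : ℕ) : ℝ)⁻¹) {t : ℝ}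
    (ht : ∀ w : Fin m → EuclideanSpace ℝ (Fin n), (∀ i, w i ∈ S) → innerιMulti c w ≤ t) :
    r ≤ 2 * t := by
  obtain ⟨_, ⟨u, hu, rfl⟩, hr⟩ := hc.1
  choose w hwS hw using fun i => hnet (u i) (hu.1 i).le
  have hm' : (0 : ℝ) < m := by exact_mod_cast hm
  -- The form is `r * m`-Lipschitz on tuples of unit-ball vectors, so moving to the net costs at
  -- most `r / 2`, which is absorbed into `r`.
  have h1 := (innerιMulti c).toMultilinearMap.norm_image_sub_le_of_bound (hc.nonneg hm)
    (fun v => hc.abs_innerιMulti_le hm hmn v) u w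
  have h2 : max ‖u‖ ‖w‖ ≤ 1 := by
    refine max_le ?_ ?_ <;> rw [pi_norm_le_iff_of_nonneg zero_le_one]
    · exact fun i => (hu.1 i).le
    · exact fun i => hS _ (hwS i)
  have h3 : ‖u - w‖ ≤ ((2 * m : ℕ) : ℝ)⁻¹ := by
    rw [pi_norm_le_iff_of_nonneg (by positivity)]
    exact hw
  have h4 : ‖innerιMulti c u - innerιMulti c w‖ ≤ r * m * 1 * ((2 * m : ℕ) : ℝ)⁻¹ := by
    refine h1.trans ?_
    rw [Fintype.card_fin]
    have := hc.nonneg hm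
    gcongr
    exact pow_le_one₀ (le_max_of_le_left (norm_nonneg _)) h2
  have h5 : r * m * 1 * ((2 * m : ℕ) : ℝ)⁻¹ = r / 2 := by
    push_cast
    field_simp
  rw [h5] at h4
  have h6 := (le_abs_self _).trans h4
  have h7 := ht w hwS
  have h8 : innerιMulti c u = r := hr
  linarith

theorem HasComass.isCalibration_smul {c : ⋀[ℝ]^m (EuclideanSpace ℝ (Fin n))} {r : ℝ}
    (hc : HasComass c r) (hr : 0 < r) : IsCalibration (r⁻¹ • c) := by
  obtain ⟨⟨x, hx, hxr⟩, hmax⟩ := hc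
  refine ⟨⟨x, hx, ?_⟩, ?_⟩
  · change inner ℝ c x = r at hxr
    change inner ℝ (r⁻¹ • c) x = 1
    rw [inner_smul_left_exteriorPower, hxr, inv_mul_cancel₀ hr.ne']
  · rintro _ ⟨y, hy, rfl⟩
    change inner ℝ (r⁻¹ • c) y ≤ 1
    have : inner ℝ c y ≤ r := hmax ⟨y, hy, rfl⟩
    rw [inner_smul_left_exteriorPower, inv_mul_le_one₀ hr]
    exact this

theorem log_one_add_four_mul_le (hm : 1 ≤ m) :
    Real.log (1 + 4 * m) ≤ 3 * Real.log (m + 1) := by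
  have hm' : (1 : ℝ) ≤ m := by exact_mod_cast hm
  have h : 3 * Real.log (m + 1) = Real.log ((m + 1) ^ 3) := by
    rw [Real.log_pow, Nat.cast_ofNat]
  rw [h]
  refine Real.log_le_log (by positivity) ?_
  nlinarith [pow_pos (zero_lt_one.trans_le hm') 3]

/-- Some vector with all coordinates `±1` has comass at most `√(24 n m log (m + 1))`. -/
theorem exists_hasComass_sq_le (hm : 1 ≤ m) (hmn : m ≤ n) :
    ∃ (c : ⋀[ℝ]^m (EuclideanSpace ℝ (Fin n))) (r : ℝ), HasComass c r ∧ 0 < r ∧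
      r ^ 2 ≤ 24 * (n * m * Real.log (m + 1)) ∧ inner ℝ c c = (n.choose m : ℝ) := by
  classical
  have hm' : (1 : ℝ) ≤ m := by exact_mod_cast hm
  have hn' : (1 : ℝ) ≤ n := by exact_mod_cast hm.trans hmn
  obtain ⟨S, hS, hScard, hnet⟩ :=
    exists_finset_net_unit_ball (EuclideanSpace ℝ (Fin n)) (k := 2 * m) (by omega)
  rw [finrank_euclideanSpace_fin] at hScard
  let b := (EuclideanSpace.basisFun (Fin n) ℝ).exteriorPower m
  let coord (w : Fin m → EuclideanSpace ℝ (Fin n)) (s : Set.powersetCard (Fin n) m) : ℝ :=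
    inner ℝ (b s) (exteriorPower.ιMulti ℝ m w)
  let T := (Fintype.piFinset fun _ : Fin m => S).image coord
  -- `exp L` is the bound `(1 + 4m)^(nm)` on the number of `m`-tuples from the net.
  set L : ℝ := n * m * Real.log (1 + 4 * m) with hL
  have hLpos : 0 < L := by
    have : 0 < Real.log (1 + 4 * m) := Real.log_pos (by linarith)
    positivity
  have hT : ∀ x ∈ T, ∑ s, x s ^ 2 ≤ 1 := by
    intro x hx
    obtain ⟨w, hw, rfl⟩ := Finset.mem_image.1 hx
    have h := b.sum_sq_norm_inner_right (exteriorPower.ιMulti ℝ m w)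
    simp only [Real.norm_eq_abs, sq_abs] at h
    rw [h]
    refine pow_le_one₀ (norm_nonneg _) ((norm_ιMulti_le hmn w).trans ?_)
    exact Finset.prod_le_one (fun _ _ => norm_nonneg _)
      fun i _ => hS _ (Fintype.mem_piFinset.1 hw i)
  have hTcard : (T.card : ℝ) ≤ Real.exp L := by
    have h1 : T.card ≤ ((1 + 2 * (2 * m)) ^ n) ^ m := by
      refine Finset.card_image_le.trans ?_
      rw [Fintype.card_piFinset, Finset.prod_const, Finset.card_univ, Fintype.card_fin]
      gcongr
    have h2 : Real.exp L = (((1 + 2 * (2 * m)) ^ n) ^ m : ℕ) := by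
      rw [hL, ← Nat.cast_mul, Real.exp_nat_mul, Real.exp_log (by positivity), pow_mul]
      push_cast
      ring
    rw [h2]
    exact_mod_cast h1
  obtain ⟨ε, hε, hεT⟩ := exists_sign_sum_le_sqrt T hT hLpos hTcard
  let c : ⋀[ℝ]^m (EuclideanSpace ℝ (Fin n)) := ∑ s, ε s • b s
  have hcb : ∀ s, inner ℝ c (b s) = ε s := fun s => by
    simpa using b.orthonormal.inner_left_fintype ε s
  obtain ⟨r, hr⟩ := exists_hasComass hmn c
  have hcc : inner ℝ c c = (n.choose m : ℝ) := by
    rw [real_inner_self_eq_norm_sq, ← b.sum_sq_norm_inner_left c]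
    simp only [hcb, Real.norm_eq_abs, sq_abs, hε]
    rw [Finset.sum_const, Finset.card_univ, card_powersetCard_fin, nsmul_one]
  have hrpos : 0 < r := by
    obtain ⟨s⟩ : Nonempty (Set.powersetCard (Fin n) m) := by
      rw [← Fintype.card_pos_iff, card_powersetCard_fin]
      exact Nat.choose_pos hmn
    -- A single coordinate `±1` already forces `1 ≤ r`.
    have h := hr.abs_inner_le hm (exteriorPower_basisFun_mem s)
    have h' : |inner ℝ c (b s)| = 1 := by
      rw [hcb, ← sq_eq_sq₀ (abs_nonneg _) zero_le_one, sq_abs, hε, one_pow]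
    linarith
  have hrle : r ≤ 2 * √(2 * L) := by
    refine hr.le_two_mul_of_net hm hmn hS hnet fun w hw => ?_
    have h := hεT (coord w)
      (Finset.mem_image_of_mem _ (Fintype.mem_piFinset.2 hw))
    have e : innerιMulti c w = ∑ s, ε s * coord w s := by
      simp only [innerιMulti_apply, c, sum_inner, inner_smul_left_exteriorPower, coord]
    rw [e]
    exact h
  refine ⟨c, r, hr, hrpos, ?_, hcc⟩
  calc r ^ 2 ≤ (2 * √(2 * L)) ^ 2 := by gcongr
    _ = 8 * (n * m * Real.log (1 + 4 * m)) := by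
      rw [mul_pow, Real.sq_sqrt (by positivity), hL]; ring
    _ ≤ 8 * (n * m * (3 * Real.log (m + 1))) := by
      gcongr; exact log_one_add_four_mul_le hm
    _ = _ := by ring

end

theorem theorem4p1 :
    (∀ m n : ℕ, 1 ≤ m → m ≤ n →
      ∀ c : ⋀[ℝ]^m (EuclideanSpace ℝ (Fin n)), IsCalibration c →
        inner ℝ c c ≤ (n.choose m : ℝ)) ∧
    ∃ α : ℝ, 0 < α ∧ ∀ m n : ℕ, 1 ≤ m → m ≤ n →
      ∃ c : ⋀[ℝ]^m (EuclideanSpace ℝ (Fin n)), IsCalibration c ∧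
        α * ((n : ℝ) * (m : ℝ) * Real.log ((m : ℝ) + 1))⁻¹ * (n.choose m : ℝ) ≤ inner ℝ c c := by
  refine ⟨fun m n hm _ c hc => hc.inner_self_le hm, 24⁻¹, by norm_num, fun m n hm hmn => ?_⟩
  obtain ⟨c, r, hc, hr, hrle, hcc⟩ := exists_hasComass_sq_le hm hmn
  refine ⟨r⁻¹ • c, hc.isCalibration_smul hr, ?_⟩
  rw [inner_smul_left_exteriorPower, real_inner_comm, inner_smul_left_exteriorPower, hcc, ← mul_assoc, ← mul_inv, ← mul_inv,
    ← pow_two]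
  gcongr
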